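/- Let $\mathcal A$ be a unital $C^*$-algebra. For Hilbert $\mathcal A$-modules $M,N$ let $B^a(M,N)$ be the set of bounded adjointable $\mathcal A$-linear operators $M\to N$. Consider decompositions $M=M_1\tilde\oplus N_1$, $N=M_2\tilde\oplus N_2$ into topological (not necessarily orthogonal) direct sums of closed submodules with respect to which $F\in B^a(M,N)$ has the matrix $\begin{pmatrix}F_1&0\\0&F_4\end{pmatrix}$, where $F_1:M_1\to M_2$ is an isomorphism. Write $F\in\mathcal M\Phi_+(M,N)$ if there is such a decomposition with $N_1$ finitely generated, $F\in\mathcal M\Phi_-(M,N)$ if there is one with $N_2$ finitely generated, and call $F$ $\mathcal A$-Fredholm, $F\in\mathcal M\Phi(M,N)$, if there is one with both $N_1$ and $N_2$ finitely generated (an $\mathcal M\Phi$-decomposition). Let $H_{\mathcal A}=\ell^2(\mathcal A)$ be the standard Hilbert $\mathcal A$-module and $\mathcal M\Phi(H_{\mathcal A})=\mathcal M\Phi(H_{\mathcal A},H_{\mathcal A})$. For $F\in\mathcal M\Phi(H_{\mathcal A})$ put $\operatorname{index}F=[N_1]-[N_2]\in K(\mathcal A)$ for an $\mathcal M\Phi$-decomposition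 of $F$, where $K(\mathcal A)=K_0(\mathcal A)$ is the Grothendieck group of the monoid of isomorphism classes of finitely generated projective $\mathcal A$-modules. 1. Let $M,N$ be Hilbert $\mathcal A$-modules and $F\in B^a(M,N)$. Then $F\in\mathcal M\Phi_+(M,N)$ if and only if $F^*\in\mathcal M\Phi_-(N,M)$. 2. If $F\in\mathcal M\Phi(H_{\mathcal A})$, then $F^*\in\mathcal M\Phi(H_{\mathcal A})$, the elements $\operatorname{index}F$ and $\operatorname{index}F^*$ of $K(\mathcal A)$ do not depend on the choice of the $\mathcal M\Phi$-decompositions of $F$ and of $F^*$, and $\operatorname{index}F=-\operatorname{index}F^*$. -/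

import Mathlib

universe u v w

namespace HilbertMod

open CStarModule
open scoped WithCStarModule

section basic
variable {A : Type u} [CStarAlgebra A] [PartialOrder A] [StarOrderedRing A]
variable {E : Type v} [NormedAddCommGroup E] [NormedSpace ℂ E] [Module A E] [CStarModule A E]

variable (A) in
/-- Two vectors with the same inner products against everything are equal. -/
theorem ext_inner {x y : E} (h : ∀ z : E, inner A z x = inner A z y) : x = y := by
  rw [← sub_eq_zero, ← CStarModule.inner_self (A := A)]
  rw [CStarModule.inner_sub_right, h, sub_self]

variable (A E) in
/-- In a Hilbert module the complex scalars act through the algebra. -/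
theorem isScalarTower : IsScalarTower ℂ A E :=
  ⟨fun z a x => ext_inner A fun y => by simp⟩

theorem norm_smul_le' (a : A) (x : E) : ‖a • x‖ ≤ ‖a‖ * ‖x‖ := by
  refine abs_le_of_sq_le_sq' ?_ (by positivity) |>.2
  rw [CStarModule.norm_sq_eq A, mul_pow, CStarModule.norm_sq_eq A (E := E)]
  simp only [inner_op_smul_right, inner_op_smul_left]
  calc ‖a * (inner A x x * star a)‖ ≤ ‖a‖ * (‖inner A x x‖ * ‖star a‖) :=
        (norm_mul_le _ _).trans (by gcongr; exact norm_mul_le _ _)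
    _ = _ := by rw [norm_star]; ring

/-- A self-map that is bounded below along the whole ray `S + t`, `t ≥ 0`, is invertible. -/
theorem isUnit_of_bddBelow {E : Type v} [NormedAddCommGroup E] [NormedSpace ℂ E] [CompleteSpace E]
    (S : E →L[ℂ] E) {c : ℝ} (hc : 0 < c)
    (h : ∀ t : ℝ, 0 ≤ t → ∀ y : E, c * ‖y‖ ≤ ‖S y + t • y‖) : IsUnit S := by
  have key : ∀ t s : ℝ, 0 ≤ t → |s - t| ≤ c / 2 → IsUnit (S + t • (1 : E →L[ℂ] E)) →
      IsUnit (S + s • (1 : E →L[ℂ] E)) := by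
    rintro t s ht hst ⟨u, hu⟩
    have hinv : ‖(↑u⁻¹ : E →L[ℂ] E)‖ ≤ c⁻¹ := by
      refine ContinuousLinearMap.opNorm_le_bound _ (by positivity) fun y => ?_
      have h1 := h t ht ((↑u⁻¹ : E →L[ℂ] E) y)
      have h2 : S ((↑u⁻¹ : E →L[ℂ] E) y) + t • ((↑u⁻¹ : E →L[ℂ] E) y) = y := by
        have := congrArg (fun T : E →L[ℂ] E => T y) u.mul_inv
        rw [hu] at this
        simpa using this
      rw [h2] at h1
      rw [inv_mul_eq_div, le_div_iff₀ hc, mul_comm]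
      exact h1
    have e : S + s • (1 : E →L[ℂ] E) = u * (1 - (↑u⁻¹ : E →L[ℂ] E) * ((t - s) • 1)) := by
      rw [mul_sub, mul_one, ← mul_assoc, Units.mul_inv, one_mul, hu, sub_smul]
      abel
    rw [e]
    refine u.isUnit.mul (isUnit_one_sub_of_norm_lt_one ?_)
    calc ‖(↑u⁻¹ : E →L[ℂ] E) * ((t - s) • 1)‖ ≤ c⁻¹ * (c / 2 * 1) := by
          refine (norm_mul_le _ _).trans ?_
          gcongr
          rw [norm_smul]
          gcongr
          · rw [Real.norm_eq_abs, abs_sub_comm]; exact hst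
          · exact ContinuousLinearMap.norm_id_le
      _ < 1 := by field_simp; norm_num
  have start : IsUnit (S + (2 * ‖S‖ + 1) • (1 : E →L[ℂ] E)) := by
    have hp : (0 : ℝ) < 2 * ‖S‖ + 1 := by positivity
    have e : S + (2 * ‖S‖ + 1) • (1 : E →L[ℂ] E) =
        ((2 * ‖S‖ + 1) • (1 : E →L[ℂ] E)) * (1 - (-(2 * ‖S‖ + 1)⁻¹) • S) := by
      ext y
      simp only [_root_.add_apply, _root_.smul_apply,
        mul_apply_eq_comp,
        one_apply_eq_self, neg_smul, sub_neg_eq_add, smul_add, smul_smul]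
      rw [mul_inv_cancel₀ hp.ne', one_smul, add_comm]
    rw [e]
    refine IsUnit.mul ?_ (isUnit_one_sub_of_norm_lt_one ?_)
    · exact (isUnit_one (M := E →L[ℂ] E)).smul (Units.mk0 _ hp.ne')
    · rw [norm_smul, norm_neg, norm_inv, Real.norm_of_nonneg hp.le, inv_mul_lt_iff₀ hp]
      linarith [norm_nonneg S]
  have all : ∀ n : ℕ,
      IsUnit (S + (max 0 (2 * ‖S‖ + 1 - n * (c / 2))) • (1 : E →L[ℂ] E)) := by
    intro n
    induction n with
    | zero =>
      have : max 0 (2 * ‖S‖ + 1 - ((0 : ℕ) : ℝ) * (c / 2)) = 2 * ‖S‖ + 1 := by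
        rw [max_eq_right] <;> simp; positivity
      rw [this]; exact start
    | succ n ih =>
      refine key _ _ (le_max_left _ _) ?_ ih
      refine (abs_max_sub_max_le_max _ _ _ _).trans ?_
      rw [sub_self, abs_zero]
      refine max_le (by positivity) ?_
      rw [abs_sub_comm, abs_of_nonneg] <;> push_cast <;> linarith
  obtain ⟨n, hn⟩ := exists_nat_gt ((2 * ‖S‖ + 1) / (c / 2))
  rw [div_lt_iff₀ (by positivity)] at hn
  have := all n
  rwa [max_eq_left (by linarith), zero_smul, add_zero] at this

/-- A finitely generated Hilbert module over a unital C⋆-algebra is projective. -/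
theorem projective_of_finite [CompleteSpace E] [Module.Finite A E] : Module.Projective A E := by
  have := isScalarTower A E
  obtain ⟨n, x, hx⟩ := Module.Finite.exists_fin (R := A) (M := E)
  -- the frame operator `y ↦ ∑ ⟪x i, y⟫ • x i`
  let T : C⋆ᵐᵒᵈ(A, Fin n → A) →ₗ[A] E :=
    { toFun := fun a => ∑ i, a i • x i
      map_add' := fun a b => by simp [add_smul, Finset.sum_add_distrib]
      map_smul' := fun r a => by
        rw [RingHom.id_apply, Finset.smul_sum]
        exact Finset.sum_congr rfl fun i _ => by rw [← mul_smul]; rfl }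
  let B : E →ₗ[A] C⋆ᵐᵒᵈ(A, Fin n → A) :=
    { toFun := fun y => (WithCStarModule.equiv A (Fin n → A)).symm fun i => inner A (x i) y
      map_add' := fun a b => by ext i; exact CStarModule.inner_add_right
      map_smul' := fun r a => by ext i; exact CStarModule.inner_op_smul_right }
  have hTB : ∀ (a : C⋆ᵐᵒᵈ(A, Fin n → A)) (y : E), inner A y (T a) = inner A (B y) a := by
    intro a y
    rw [WithCStarModule.pi_inner]
    change inner A y (∑ i, a i • x i) = ∑ i, a i * star (inner A (x i) y)
    simp
  have hTsurj : Function.Surjective T := by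
    intro y
    have : y ∈ Submodule.span A (Set.range x) := by rw [hx]; trivial
    obtain ⟨a, ha⟩ := (Submodule.mem_span_range_iff_exists_fun A).1 this
    exact ⟨(WithCStarModule.equiv A (Fin n → A)).symm a, by simpa [T] using ha⟩
  let Tc : C⋆ᵐᵒᵈ(A, Fin n → A) →L[ℂ] E := (T.restrictScalars ℂ).mkContinuous (∑ i, ‖x i‖) fun a => by
    rw [Finset.sum_mul]
    change ‖∑ i, a i • x i‖ ≤ _
    refine (norm_sum_le _ _).trans (Finset.sum_le_sum fun i _ => ?_)
    rw [mul_comm]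
    exact (norm_smul_le' _ _).trans
      (by gcongr; exact WithCStarModule.norm_apply_le_norm a i)
  let Bc : E →L[ℂ] C⋆ᵐᵒᵈ(A, Fin n → A) := (B.restrictScalars ℂ).mkContinuous (∑ i, ‖x i‖) fun y => by
    rw [Finset.sum_mul]
    refine (WithCStarModule.pi_norm_le_sum_norm _).trans (Finset.sum_le_sum fun i _ => ?_)
    exact norm_inner_le E
  obtain ⟨C, hC, hpre⟩ := Tc.exists_preimage_norm_le hTsurj
  have hlow : ∀ y : E, ‖y‖ ≤ C * ‖B y‖ := by
    intro y
    obtain ⟨a, ha, han⟩ := hpre y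
    rcases eq_or_ne y 0 with rfl | hy
    · simp
    have h1 : ‖y‖ ^ 2 ≤ ‖B y‖ * (C * ‖y‖) := by
      calc ‖y‖ ^ 2 = ‖inner A y (T a)‖ := by
            rw [CStarModule.norm_sq_eq A]; congr 2; exact ha.symm
        _ = ‖inner A (B y) a‖ := by rw [hTB]
        _ ≤ ‖B y‖ * ‖a‖ := norm_inner_le C⋆ᵐᵒᵈ(A, Fin n → A)
        _ ≤ _ := by gcongr
    have hy' : 0 < ‖y‖ := norm_pos_iff.2 hy
    nlinarith
  have hunit : IsUnit (Tc ∘L Bc) := by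
    refine isUnit_of_bddBelow (c := (C ^ 2)⁻¹) _ (by positivity) fun t ht y => ?_
    rcases eq_or_ne y 0 with rfl | hy
    · simp
    have hy' : 0 < ‖y‖ := norm_pos_iff.2 hy
    have h1 : ‖inner A (B y) (B y)‖ ≤ ‖y‖ * ‖T (B y) + t • y‖ := by
      calc ‖inner A (B y) (B y)‖ ≤ ‖inner A y (T (B y) + t • y)‖ := by
            refine CStarAlgebra.norm_le_norm_of_nonneg_of_le inner_self_nonneg ?_
            rw [CStarModule.inner_add_right, hTB, CStarModule.inner_smul_right_real]
            exact le_add_of_nonneg_right (smul_nonneg ht inner_self_nonneg)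
        _ ≤ _ := norm_inner_le E
    rw [← CStarModule.norm_sq_eq A] at h1
    have h2 := hlow y
    have h3 : ‖y‖ ^ 2 ≤ C ^ 2 * (‖y‖ * ‖T (B y) + t • y‖) := by
      calc ‖y‖ ^ 2 ≤ (C * ‖B y‖) ^ 2 := by gcongr
        _ = C ^ 2 * ‖B y‖ ^ 2 := by ring
        _ ≤ _ := by gcongr
    change (C ^ 2)⁻¹ * ‖y‖ ≤ ‖T (B y) + t • y‖
    rw [inv_mul_le_iff₀ (by positivity)]
    nlinarith
  have hbij : Function.Bijective (T ∘ₗ B) := by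
    obtain ⟨u, hu⟩ := hunit
    have h := (ContinuousLinearEquiv.unitsEquiv ℂ E u).bijective
    have e : ∀ y, ContinuousLinearEquiv.unitsEquiv ℂ E u y = (T ∘ₗ B) y := fun y => by
      rw [ContinuousLinearEquiv.unitsEquiv_apply, hu]; rfl
    rwa [show (⇑(ContinuousLinearEquiv.unitsEquiv ℂ E u)) = ⇑(T ∘ₗ B) from funext e] at h
  let e := LinearEquiv.ofBijective (T ∘ₗ B) hbij
  have : Module.Projective A C⋆ᵐᵒᵈ(A, Fin n → A) := inferInstanceAs (Module.Projective A (Fin n → A))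
  refine Module.Projective.of_split (B ∘ₗ e.symm.toLinearMap) T ?_
  ext y
  exact e.apply_symm_apply y

/-- A finitely generated closed submodule of a Hilbert module is projective. -/
theorem projective_submodule [CompleteSpace E] (N : Submodule A E) (hcl : IsClosed (N : Set E))
    (hfg : N.FG) : Module.Projective A N := by
  have := isScalarTower A E
  have : CompleteSpace N := hcl.completeSpace_coe
  have : Module.Finite A N := Module.Finite.of_fg hfg
  let : CStarModule A N :=
    { inner := fun x y => inner A (x : E) (y : E)
      inner_add_right := by simp
      inner_self_nonneg := CStarModule.inner_self_nonneg
      inner_self := by intro x; rw [CStarModule.inner_self]; simp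
      inner_op_smul_right := by simp
      inner_smul_right_complex := by simp
      star_inner := by simp
      norm_eq_sqrt_norm_inner_self := fun x =>
        CStarModule.norm_eq_sqrt_norm_inner_self (A := A) (x : E) }
  exact projective_of_finite
end basic

section StandardModule
variable (A : Type u) [CStarAlgebra A]

/-- The norm of the restriction of a sequence to a finite set of indices. -/
noncomputable def finNorm {A : Type u} [CStarAlgebra A] (s : Finset ℕ) (x : ℕ → A) : ℝ :=
  √‖∑ i ∈ s, x i * star (x i)‖

theorem finNorm_sq {A : Type u} [CStarAlgebra A] (s : Finset ℕ) (x : ℕ → A) :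
    finNorm s x ^ 2 = ‖∑ i ∈ s, x i * star (x i)‖ := Real.sq_sqrt (norm_nonneg _)

section order
variable {A} [PartialOrder A] [StarOrderedRing A]

theorem finNorm_eq (s : Finset ℕ) (x : ℕ → A) :
    finNorm s x = ‖(WithCStarModule.equiv A (s → A)).symm fun i => x i‖ := by
  rw [WithCStarModule.pi_norm, finNorm]
  congr 2
  exact (Finset.sum_coe_sort s fun i => x i * star (x i)).symm

theorem finNorm_add_le (s : Finset ℕ) (x y : ℕ → A) :
    finNorm s (x + y) ≤ finNorm s x + finNorm s y := by
  simp only [finNorm_eq]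
  exact norm_add_le ((WithCStarModule.equiv A (s → A)).symm fun i => x i)
    ((WithCStarModule.equiv A (s → A)).symm fun i => y i)

theorem norm_finInner_le (s : Finset ℕ) (x y : ℕ → A) :
    ‖∑ i ∈ s, y i * star (x i)‖ ≤ finNorm s x * finNorm s y := by
  simp only [finNorm_eq]
  have h := CStarModule.norm_inner_le (A := A) C⋆ᵐᵒᵈ(A, s → A)
    (x := (WithCStarModule.equiv A (s → A)).symm fun i => x i)
    (y := (WithCStarModule.equiv A (s → A)).symm fun i => y i)
  rw [WithCStarModule.pi_inner] at h
  rw [← Finset.sum_coe_sort s fun i => y i * star (x i)]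
  exact h

end order

theorem summable_iff_finNorm {A : Type u} [CStarAlgebra A] (x : ℕ → A) :
    (Summable fun i => x i * star (x i)) ↔
      ∀ ε > 0, ∃ s : Finset ℕ, ∀ t, Disjoint t s → finNorm t x < ε := by
  rw [summable_iff_vanishing_norm]
  constructor
  · intro h ε hε
    obtain ⟨s, hs⟩ := h (ε ^ 2) (by positivity)
    refine ⟨s, fun t ht => ?_⟩
    have := hs t ht
    rw [← finNorm_sq] at this
    exact lt_of_pow_lt_pow_left₀ 2 hε.le this
  · intro h ε hε
    obtain ⟨s, hs⟩ := h (√ε) (by positivity)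
    refine ⟨s, fun t ht => ?_⟩
    rw [← finNorm_sq, ← Real.sq_sqrt hε.le]
    exact pow_lt_pow_left₀ (hs t ht) (Real.sqrt_nonneg _) two_ne_zero

variable [PartialOrder A] [StarOrderedRing A]

/-- The sequences `x` in `A` for which `∑ x i (x i)⋆` converges in norm, as a submodule of the
left `A`-module of all sequences. (For series of positive elements, convergence of the partial
sums and unconditional convergence are the same.) -/
def ell2 : Submodule A (ℕ → A) where
  carrier := {x | Summable fun i => x i * star (x i)}
  zero_mem' := by simp [summable_zero]
  add_mem' := by
    intro x y hx hy
    rw [Set.mem_ofPred_eq, summable_iff_finNorm] at *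
    intro ε hε
    obtain ⟨s, hs⟩ := hx (ε / 2) (by positivity)
    obtain ⟨s', hs'⟩ := hy (ε / 2) (by positivity)
    refine ⟨s ∪ s', fun t ht => ?_⟩
    rw [Finset.disjoint_union_right] at ht
    linarith [finNorm_add_le t x y, hs t ht.1, hs' t ht.2]
  smul_mem' := by
    intro r x hx
    have := (hx.mul_left r).mul_right (star r)
    simpa [mul_assoc] using this

/-- The standard Hilbert module `H_A = ℓ²(A)`: square-summable sequences in `A`, with
`⟪x, y⟫ = ∑ y i (x i)⋆` and `‖x‖ = ‖⟪x, x⟫‖ ^ (1/2)`. -/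
def StandardModule : Type u := ell2 A

namespace StandardModule

noncomputable instance : AddCommGroup (StandardModule A) := inferInstanceAs (AddCommGroup (ell2 A))
noncomputable instance : Module A (StandardModule A) := inferInstanceAs (Module A (ell2 A))
noncomputable instance : Module ℂ (StandardModule A) := inferInstanceAs (Module ℂ (ell2 A))

variable {A}

/-- The `i`-th entry of an element of the standard module. -/
def coord (x : StandardModule A) (i : ℕ) : A := x.1 i

@[ext] theorem ext {x y : StandardModule A} (h : ∀ i, x.coord i = y.coord i) : x = y :=
  Subtype.ext (funext h)

@[simp] theorem coord_zero (i : ℕ) : (0 : StandardModule A).coord i = 0 := rfl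
@[simp] theorem coord_add (x y : StandardModule A) (i : ℕ) :
    (x + y).coord i = x.coord i + y.coord i := rfl
@[simp] theorem coord_sub (x y : StandardModule A) (i : ℕ) :
    (x - y).coord i = x.coord i - y.coord i := rfl
@[simp] theorem coord_smul (a : A) (x : StandardModule A) (i : ℕ) :
    (a • x).coord i = a * x.coord i := rfl
@[simp] theorem coord_smul_complex (z : ℂ) (x : StandardModule A) (i : ℕ) :
    (z • x).coord i = z • x.coord i := rfl

theorem summable_self (x : StandardModule A) :
    Summable fun i => x.coord i * star (x.coord i) := x.2

theorem summable_inner (x y : StandardModule A) :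
    Summable fun i => y.coord i * star (x.coord i) := by
  rw [summable_iff_vanishing_norm]
  intro ε hε
  obtain ⟨s, hs⟩ := (summable_iff_finNorm x.coord).1 x.summable_self 1 one_pos
  obtain ⟨s', hs'⟩ := (summable_iff_finNorm y.coord).1 y.summable_self ε hε
  refine ⟨s ∪ s', fun t ht => ?_⟩
  rw [Finset.disjoint_union_right] at ht
  have h0 : 0 ≤ finNorm t x.coord := Real.sqrt_nonneg _
  have h0' : 0 ≤ finNorm t y.coord := Real.sqrt_nonneg _
  have := norm_finInner_le t x.coord y.coord
  nlinarith [hs t ht.1, hs' t ht.2]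

noncomputable instance : Norm (StandardModule A) where
  norm x := √‖∑' i, x.coord i * star (x.coord i)‖

noncomputable instance : CStarModule A (StandardModule A) where
  inner x y := ∑' i, y.coord i * star (x.coord i)
  inner_add_right {x y z} := by
    rw [← (summable_inner x y).tsum_add (summable_inner x z)]
    simp [add_mul]
  inner_self_nonneg := tsum_nonneg fun i => mul_star_self_nonneg _
  inner_self {x} := by
    constructor
    · intro h
      have h0 := (hasSum_zero_iff_of_nonneg fun i => mul_star_self_nonneg (x.coord i)).1
        (h ▸ x.summable_self.hasSum)
      ext i
      exact (CStarRing.mul_star_self_eq_zero_iff _).1 (congrFun h0 i)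
    · rintro rfl
      simp
  inner_op_smul_right {a x y} := by
    rw [← (summable_inner x y).tsum_mul_left]
    simp [mul_assoc]
  inner_smul_right_complex {z x y} := by
    rw [← (summable_inner x y).tsum_const_smul]
    simp
  star_inner x y := by
    rw [tsum_star]
    simp
  norm_eq_sqrt_norm_inner_self _ := rfl

theorem inner_def (x y : StandardModule A) :
    inner A x y = ∑' i, y.coord i * star (x.coord i) := rfl

noncomputable instance : NormedAddCommGroup (StandardModule A) := CStarModule.normedAddCommGroup A
noncomputable instance : NormedSpace ℂ (StandardModule A) :=
  NormedSpace.ofCore (CStarModule.normedSpaceCore A)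

theorem finNorm_le_norm (s : Finset ℕ) (x : StandardModule A) : finNorm s x.coord ≤ ‖x‖ := by
  rw [CStarModule.norm_eq_sqrt_norm_inner_self (A := A)]
  refine Real.sqrt_le_sqrt (CStarAlgebra.norm_le_norm_of_nonneg_of_le
    (Finset.sum_nonneg fun i _ => mul_star_self_nonneg _) ?_)
  exact x.summable_self.sum_le_tsum s fun i _ => mul_star_self_nonneg _

theorem norm_le_of_finNorm {x : StandardModule A} {c : ℝ} (hc : 0 ≤ c)
    (h : ∀ s, finNorm s x.coord ≤ c) : ‖x‖ ≤ c := by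
  rw [CStarModule.norm_eq_sqrt_norm_inner_self (A := A), Real.sqrt_le_left hc]
  refine le_of_tendsto x.summable_self.hasSum.norm (Filter.Eventually.of_forall fun s => ?_)
  rw [← finNorm_sq]
  exact pow_le_pow_left₀ (Real.sqrt_nonneg _) (h s) 2

theorem norm_coord_le (x : StandardModule A) (i : ℕ) : ‖x.coord i‖ ≤ ‖x‖ := by
  have := finNorm_le_norm {i} x
  rwa [finNorm, Finset.sum_singleton, CStarRing.norm_self_mul_star,
    Real.sqrt_mul_self (norm_nonneg _)] at this

instance : CompleteSpace (StandardModule A) := by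
  refine Metric.complete_of_cauchySeq_tendsto fun u hu => ?_
  rw [Metric.cauchySeq_iff] at hu
  have hc : ∀ i, CauchySeq fun n => (u n).coord i := by
    intro i
    rw [Metric.cauchySeq_iff]
    intro ε hε
    obtain ⟨n, hn⟩ := hu ε hε
    refine ⟨n, fun k hk l hl => ?_⟩
    refine lt_of_le_of_lt ?_ (hn k hk l hl)
    rw [dist_eq_norm, dist_eq_norm, ← coord_sub]
    exact norm_coord_le _ i
  choose a ha using fun i => cauchySeq_tendsto_of_complete (hc i)
  have hlim : ∀ ε > 0, ∃ n, ∀ k ≥ n, ∀ s, finNorm s (a - (u k).coord) ≤ ε := by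
    intro ε hε
    obtain ⟨n, hn⟩ := hu ε hε
    refine ⟨n, fun k hk s => ?_⟩
    have ht : Filter.Tendsto (fun l => finNorm s ((u l).coord - (u k).coord)) Filter.atTop
        (nhds (finNorm s (a - (u k).coord))) := by
      refine ((Real.continuous_sqrt.tendsto _).comp
        (tendsto_finsetSum s fun i _ => ?_).norm)
      have := (ha i).sub_const ((u k).coord i)
      exact this.mul this.star
    refine le_of_tendsto ht (Filter.eventually_atTop.2 ⟨n, fun l hl => ?_⟩)
    refine (finNorm_le_norm s (u l - u k)).trans ?_
    rw [← dist_eq_norm]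
    exact (hn l hl k hk).le
  have hmem : Summable fun i => a i * star (a i) := by
    rw [summable_iff_finNorm]
    intro ε hε
    obtain ⟨n, hn⟩ := hlim (ε / 2) (by positivity)
    obtain ⟨s, hs⟩ := (summable_iff_finNorm _).1 (u n).summable_self (ε / 2) (by positivity)
    refine ⟨s, fun t ht => ?_⟩
    have h1 := finNorm_add_le t (a - (u n).coord) (u n).coord
    rw [sub_add_cancel] at h1
    linarith [hn n le_rfl t, hs t ht]
  let b : StandardModule A := ⟨a, hmem⟩
  refine ⟨b, ?_⟩
  rw [Metric.tendsto_atTop]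
  intro ε hε
  obtain ⟨n, hn⟩ := hlim (ε / 2) (by positivity)
  refine ⟨n, fun k hk => ?_⟩
  rw [dist_comm, dist_eq_norm]
  refine lt_of_le_of_lt (norm_le_of_finNorm (by positivity) fun s => hn k hk s)
    (half_lt_self hε)

end StandardModule
end StandardModule

section KTheory
variable (A : Type u) [Ring A]

/-- A finitely generated projective module over `A`. -/
structure FGProjective where
  carrier : Type u
  [addCommGroup : AddCommGroup carrier]
  [module : Module A carrier]
  [finite : Module.Finite A carrier]
  [projective : Module.Projective A carrier]

attribute [instance] FGProjective.addCommGroup FGProjective.module FGProjective.finite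
  FGProjective.projective

/-- Two modules are equivalent when they are isomorphic over `A`. -/
instance FGProjective.setoid : Setoid (FGProjective A) where
  r P Q := Nonempty (P.carrier ≃ₗ[A] Q.carrier)
  iseqv :=
    { refl := fun _ => ⟨LinearEquiv.refl A _⟩
      symm := fun ⟨e⟩ => ⟨e.symm⟩
      trans := fun ⟨e⟩ ⟨f⟩ => ⟨e.trans f⟩ }

/-- The isomorphism classes of finitely generated projective modules over `A`. -/
def IsoClass : Type (u + 1) := Quotient (FGProjective.setoid A)

/-- The sum of two isomorphism classes is the class of the direct sum. -/
instance : Add (IsoClass A) where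
  add := Quotient.map₂ (fun P Q => ⟨P.carrier × Q.carrier⟩)
    fun _ _ ⟨e⟩ _ _ ⟨f⟩ => ⟨e.prodCongr f⟩

instance : Zero (IsoClass A) where
  zero := Quotient.mk (FGProjective.setoid A) ⟨PUnit⟩

/-- Isomorphism classes form a commutative monoid under direct sums. -/
instance : AddCommMonoid (IsoClass A) where
  nsmul := nsmulRec
  add_assoc := by
    rintro ⟨P⟩ ⟨Q⟩ ⟨R⟩
    exact Quotient.sound ⟨LinearEquiv.prodAssoc A P.carrier Q.carrier R.carrier⟩
  zero_add := by
    rintro ⟨P⟩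
    exact Quotient.sound ⟨LinearEquiv.uniqueProd⟩
  add_zero := by
    rintro ⟨P⟩
    exact Quotient.sound ⟨LinearEquiv.prodUnique⟩
  add_comm := by
    rintro ⟨P⟩ ⟨Q⟩
    exact Quotient.sound ⟨LinearEquiv.prodComm A P.carrier Q.carrier⟩

/-- The group `K(A) = K₀(A)`: the Grothendieck group of the monoid of isomorphism classes of
finitely generated projective modules. -/
abbrev KGroup : Type (u + 1) := Algebra.GrothendieckAddGroup (IsoClass A)

variable {A}

/-- The class `[P]` in `K(A)` of a finitely generated projective module. -/
def KGroup.cls (P : FGProjective A) : KGroup A :=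
  Algebra.GrothendieckAddGroup.of (Quotient.mk (FGProjective.setoid A) P : IsoClass A)

end KTheory

section Fredholm
variable (A : Type u) [CStarAlgebra A] [PartialOrder A] [StarOrderedRing A]
variable (M : Type v) [NormedAddCommGroup M] [NormedSpace ℂ M] [Module A M] [CStarModule A M]
variable (N : Type w) [NormedAddCommGroup N] [NormedSpace ℂ N] [Module A N] [CStarModule A N]

/-- `B^a(M, N)`: the bounded adjointable `A`-linear operators from `M` to `N`. An operator is
stored together with its adjoint, which it determines (`AdjointableMap.ext`). -/
structure AdjointableMap where
  toCLM : M →L[A] N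
  adjCLM : N →L[A] M
  inner_adj : ∀ (x : M) (y : N), inner A (toCLM x) y = inner A x (adjCLM y)

variable {A M N}

/-- The adjoint `F* : N → M` of `F : M → N`. -/
def AdjointableMap.adjoint (F : AdjointableMap A M N) : AdjointableMap A N M where
  toCLM := F.adjCLM
  adjCLM := F.toCLM
  inner_adj y x := by
    rw [← CStarModule.star_inner x, ← F.inner_adj, CStarModule.star_inner]

theorem AdjointableMap.ext {F G : AdjointableMap A M N} (h : F.toCLM = G.toCLM) : F = G := by
  obtain ⟨F, F', hF⟩ := F
  obtain ⟨G, G', hG⟩ := G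
  obtain rfl : F = G := h
  have : F' = G' := by
    ext y
    exact ext_inner A fun x => by rw [← hF, hG]
  subst this
  rfl

/-- A decomposition `M = M₁ ⊕ N₁ → M₂ ⊕ N₂ = N` into topological direct sums of closed submodules
(not necessarily orthogonal), with respect to which `F` has the matrix `diag(F₁, F₄)`, where
`F₁ : M₁ → M₂` is an isomorphism. -/
structure Decomposition (F : AdjointableMap A M N) where
  M₁ : Submodule A M
  N₁ : Submodule A M
  M₂ : Submodule A N
  N₂ : Submodule A N
  isClosed_M₁ : IsClosed (M₁ : Set M)
  isClosed_N₁ : IsClosed (N₁ : Set M)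
  isClosed_M₂ : IsClosed (M₂ : Set N)
  isClosed_N₂ : IsClosed (N₂ : Set N)
  isCompl_dom : IsCompl M₁ N₁
  isCompl_cod : IsCompl M₂ N₂
  F₁ : M₁ ≃L[A] M₂
  apply_M₁ : ∀ x : M₁, F.toCLM x = F₁ x
  apply_N₁ : ∀ x ∈ N₁, F.toCLM x ∈ N₂

variable (A M N)

/-- `MΦ₊(M, N)`: the upper semi-`A`-Fredholm operators, for which `N₁` can be chosen finitely
generated. -/
def MPhiPlus : Set (AdjointableMap A M N) :=
  {F | ∃ D : Decomposition F, D.N₁.FG}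

/-- `MΦ₋(M, N)`: the lower semi-`A`-Fredholm operators, for which `N₂` can be chosen finitely
generated. -/
def MPhiMinus : Set (AdjointableMap A M N) :=
  {F | ∃ D : Decomposition F, D.N₂.FG}

/-- `MΦ(M, N)`: the `A`-Fredholm operators, for which `N₁` and `N₂` can be chosen finitely
generated in one and the same decomposition. -/
def MPhi : Set (AdjointableMap A M N) :=
  {F | ∃ D : Decomposition F, D.N₁.FG ∧ D.N₂.FG}

end Fredholm

section Index
variable {A : Type u} [CStarAlgebra A] [PartialOrder A] [StarOrderedRing A]
variable {M : Type u} [NormedAddCommGroup M] [NormedSpace ℂ M] [Module A M] [CStarModule A M]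
  [CompleteSpace M]
variable {N : Type u} [NormedAddCommGroup N] [NormedSpace ℂ N] [Module A N] [CStarModule A N]
  [CompleteSpace N]

/-- The class in `K(A)` of a finitely generated closed submodule, which is projective. -/
def submoduleClass (P : Submodule A M) (hcl : IsClosed (P : Set M)) (hfg : P.FG) : KGroup A :=
  have : Module.Finite A P := Module.Finite.of_fg hfg
  have : Module.Projective A P := projective_submodule P hcl hfg
  KGroup.cls ⟨P⟩

/-- The element `[N₁] - [N₂]` of `K(A)` given by a Fredholm decomposition. -/
def Decomposition.index {F : AdjointableMap A M N} (D : Decomposition F)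
    (h₁ : D.N₁.FG) (h₂ : D.N₂.FG) : KGroup A :=
  submoduleClass D.N₁ D.isClosed_N₁ h₁ - submoduleClass D.N₂ D.isClosed_N₂ h₂

/-- The index of an `A`-Fredholm operator: `[N₁] - [N₂]` for some Fredholm decomposition. -/
noncomputable def index (F : AdjointableMap A M N) (hF : F ∈ MPhi A M N) : KGroup A :=
  hF.choose.index hF.choose_spec.1 hF.choose_spec.2

end Index

end HilbertMod

open HilbertMod

/-
A decomposition of `F` as `diag(F₁, F₄)` is the same thing as a bounded operator `G` with
`G F G = G`: from the decomposition, `G = diag(F₁⁻¹, 0)`, and from `G`, the complements are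
`N₁ = ker (G F)` and `N₂ = ker G`. For two such operators `G`, `G'` there is an explicit
isomorphism `ker (G F) ⊕ ker G' ≃ ker G ⊕ ker (G' F)`, so `[N₁] - [N₂]` does not depend on `G`.

A finitely generated closed submodule is the range of an adjointable operator `Aⁿ → M`, and closed
ranges of adjointable operators are orthogonally complemented. If `N₁` is orthogonally complemented,
the restriction `T` of `F` to `N₁ᗮ` is bounded below; if `N₂` is, the compression `T` of `F` to
`N₂ᗮ` is surjective. Then `T* T`, respectively `T T*`, is invertible, and its inverse
yields an operator `H` with `H F* H = H`, `ker H = N₁` and `N₂` complementary to the range of `H`,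
hence isomorphic to `ker (H F*)`: passing to the adjoint exchanges the classes of `N₁` and `N₂`.
-/

namespace HilbertMod

open CStarModule Function
open scoped WithCStarModule

section OuterInverse

/-- `g` is an outer inverse of `f`: only one of the two Penrose equations `g f g = g` and
`f g f = f` is required, so that the restriction of `f` to the range of `g` is inverted by `g`,
while nothing is asked of `f` on a complement. -/
def IsOuterInverse {α β : Type*} (f : α → β) (g : β → α) : Prop :=
  ∀ y, g (f (g y)) = g y

namespace IsOuterInverse

variable {R : Type*} [Ring R] {M N : Type*} [AddCommGroup M] [Module R M]
  [AddCommGroup N] [Module R N]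

/-- For two outer inverses `g`, `g'` of `f`, the isomorphism
`ker (g f) ⊕ ker g' ≃ ker g ⊕ ker (g' f)`, by which the formal difference
`[ker (g f)] - [ker g]` does not depend on `g`. Both sides parametrise the same vectors
`z = n - g c = g' a + b`. -/
def kerCompProdKerEquiv {f : M →ₗ[R] N} {g g' : N →ₗ[R] M} (hg : IsOuterInverse f g)
    (hg' : IsOuterInverse f g') :
    ((g ∘ₗ f).ker × g'.ker) ≃ₗ[R] g.ker × (g' ∘ₗ f).ker where
  toFun := fun ⟨⟨n, hn⟩, ⟨c, _⟩⟩ =>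
    let z := n - g c
    have hgfn : g (f n) = 0 := hn
    ⟨⟨c + f z, by simp [z, hgfn, hg c]⟩, ⟨z - g' (f z), by simp [hg' (f z)]⟩⟩
  invFun := fun ⟨⟨a, _⟩, ⟨b, hb⟩⟩ =>
    let z := g' a + b
    ⟨⟨z - g (f z), by simp [hg (f z)]⟩, ⟨a - f z, by
      have hgfb : g' (f b) = 0 := hb
      simp [z, hgfb, hg' a]⟩⟩
  map_add' := by
    rintro ⟨⟨n, hn⟩, ⟨c, hc⟩⟩ ⟨⟨n', hn'⟩, ⟨c', hc'⟩⟩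
    ext <;> simp <;> abel
  map_smul' := by
    rintro r ⟨⟨n, hn⟩, ⟨c, hc⟩⟩
    ext <;> simp [smul_sub]
  left_inv := by
    rintro ⟨⟨n, hn⟩, ⟨c, hc⟩⟩
    have hgfn : g (f n) = 0 := hn
    have hgc : g' c = 0 := hc
    let z := n - g c
    have hz : g' (c + f z) + (z - g' (f z)) = z := by
      rw [map_add, hgc, zero_add, add_sub_cancel]
    refine Prod.ext (Subtype.ext ?_) (Subtype.ext ?_)
    · change g' (c + f z) + (z - g' (f z)) - g (f (g' (c + f z) + (z - g' (f z)))) = n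
      rw [hz]
      simp [z, hgfn, hg c]
    · change c + f z - f (g' (c + f z) + (z - g' (f z))) = c
      rw [hz, add_sub_cancel_right]
  right_inv := by
    rintro ⟨⟨a, ha⟩, ⟨b, hb⟩⟩
    have hga : g a = 0 := ha
    have hgfb : g' (f b) = 0 := hb
    let z := g' a + b
    have hz : z - g (f z) - g (a - f z) = z := by
      rw [map_sub, hga, zero_sub, sub_neg_eq_add, sub_add_cancel]
    refine Prod.ext (Subtype.ext ?_) (Subtype.ext ?_)
    · change a - f z + f (z - g (f z) - g (a - f z)) = a
      rw [hz, sub_add_cancel]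
    · change z - g (f z) - g (a - f z) - g' (f (z - g (f z) - g (a - f z))) = b
      rw [hz]
      simp [z, hgfb, hg' a]

variable [TopologicalSpace M] [TopologicalSpace N] {f : M →L[R] N} {g : N →L[R] M}

theorem isTopCompl_range_ker_comp (h : IsOuterInverse f g) :
    Submodule.IsTopCompl g.range (g ∘L f).ker := by
  have hidem : IsIdempotentElem (g ∘L f) := ContinuousLinearMap.ext fun x => h (f x)
  have hrange : (g ∘L f).range = g.range :=
    le_antisymm (LinearMap.range_comp_le_range _ _) fun _ ⟨y, hy⟩ => ⟨g y, (h y).trans hy⟩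
  exact hrange ▸ ContinuousLinearMap.IsIdempotentElem.isTopCompl hidem

/-- `ker (g f)` is isomorphic to any other complement of the range of `g`. -/
noncomputable def kerCompEquivOfIsCompl (h : IsOuterInverse f g) {q : Submodule R M}
    (hq : IsCompl g.range q) : (g ∘L f).ker ≃ₗ[R] q :=
  (Submodule.quotientEquivOfIsCompl _ _ h.isTopCompl_range_ker_comp.isCompl).symm.trans
    (Submodule.quotientEquivOfIsCompl _ _ hq)

theorem isTopCompl_range_comp_ker (h : IsOuterInverse f g) :
    Submodule.IsTopCompl (f ∘L g).range g.ker := by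
  have hidem : IsIdempotentElem (f ∘L g) := ContinuousLinearMap.ext fun y => congrArg f (h y)
  have hker : (f ∘L g).ker = g.ker :=
    le_antisymm (fun y hy => (h y).symm.trans ((congrArg g hy).trans g.map_zero))
      (LinearMap.ker_le_ker_comp _ _)
  exact hker ▸ ContinuousLinearMap.IsIdempotentElem.isTopCompl hidem

/-- `f` as an isomorphism from the range of an outer inverse `g` onto the range of `f g`. -/
def rangeEquiv (h : IsOuterInverse f g) : g.range ≃L[R] (f ∘L g).range where
  toFun x := ⟨f x, x.2.imp fun _ hy => congrArg f hy⟩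
  invFun y := ⟨g y, y, rfl⟩
  map_add' x y := Subtype.ext (map_add f _ _)
  map_smul' r x := Subtype.ext (map_smul f r _)
  left_inv := by rintro ⟨_, y, rfl⟩; exact Subtype.ext (h y)
  right_inv := by rintro ⟨_, y, rfl⟩; exact Subtype.ext (congrArg f (h y))
  continuous_toFun := (f.continuous.comp continuous_subtype_val).subtype_mk _
  continuous_invFun := (g.continuous.comp continuous_subtype_val).subtype_mk _

end IsOuterInverse

end OuterInverse

section OrthogonalComplement

attribute [local instance] isScalarTower

theorem isTopCompl_of_isClosed {R : Type*} [Ring R] (𝕜 : Type*) [NontriviallyNormedField 𝕜]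
    [SMul 𝕜 R] {E : Type*} [NormedAddCommGroup E] [NormedSpace 𝕜 E] [Module R E]
    [IsScalarTower 𝕜 R E] [CompleteSpace E] {p q : Submodule R E} (h : IsCompl p q)
    (hp : IsClosed (p : Set E)) (hq : IsClosed (q : Set E)) : p.IsTopCompl q := by
  have := hp.completeSpace_coe
  have := hq.completeSpace_coe
  rw [Submodule.IsCompl.isTopCompl_iff_continuous_symm_prodEquivOfIsCompl h]
  exact ((p.prodEquivOfIsCompl q h).restrictScalars 𝕜).continuous_symm
    (Submodule.continuous_prodEquivOfIsCompl h)

variable {A : Type u} [CStarAlgebra A] [PartialOrder A]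
  {E : Type v} [NormedAddCommGroup E] [NormedSpace ℂ E] [Module A E] [CStarModule A E]
  {F : Type w} [NormedAddCommGroup F] [NormedSpace ℂ F] [Module A F] [CStarModule A F]

/-- The orthogonal complement of a submodule of a Hilbert module. Over a `C⋆`-algebra it need not
be a complement, even of a closed submodule. -/
def orthogonal (p : Submodule A E) : Submodule A E where
  carrier := {y | ∀ x ∈ p, inner A x y = 0}
  add_mem' ha hb x hx := by rw [CStarModule.inner_add_right, ha x hx, hb x hx, add_zero]
  zero_mem' _ _ := inner_zero_right
  smul_mem' c a ha x hx := by rw [inner_op_smul_right, ha x hx, mul_zero]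

theorem inner_eq_zero_of_mem_orthogonal {p : Submodule A E} {x y : E} (hx : x ∈ orthogonal p)
    (hy : y ∈ p) : inner A x y = 0 := by
  rw [← star_inner, hx y hy, star_zero]

variable [StarOrderedRing A]

/-- A submodule of a Hilbert module, with the restricted inner product. -/
noncomputable instance submoduleCStarModule (p : Submodule A E) : CStarModule A p where
  inner x y := inner A (x : E) (y : E)
  inner_add_right := by simp
  inner_self_nonneg := inner_self_nonneg
  inner_self := by intro x; rw [inner_self, ZeroMemClass.coe_eq_zero]
  inner_op_smul_right := by simp
  inner_smul_right_complex := by simp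
  star_inner := by simp
  norm_eq_sqrt_norm_inner_self x := norm_eq_sqrt_norm_inner_self (x : E)

theorem exists_norm_apply_le (T : E →L[A] F) : ∃ C > 0, ∀ x, ‖T x‖ ≤ C * ‖x‖ :=
  (T.restrictScalars ℂ).bound

namespace AdjointableMap

/-- The composition `T ∘ S` of adjointable operators, with adjoint `S* ∘ T*`. -/
def comp {G : Type*} [NormedAddCommGroup G] [NormedSpace ℂ G] [Module A G] [CStarModule A G]
    (T : AdjointableMap A F G) (S : AdjointableMap A E F) : AdjointableMap A E G where
  toCLM := T.toCLM ∘L S.toCLM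
  adjCLM := S.adjCLM ∘L T.adjCLM
  inner_adj _ _ := (T.inner_adj _ _).trans (S.inner_adj _ _)

/-- The inclusion of a complemented orthogonal complement; its adjoint is the projection. -/
noncomputable def orthogonalSubtype {p : Submodule A E} (h : p.IsTopCompl (orthogonal p)) :
    AdjointableMap A (orthogonal p) E where
  toCLM := (orthogonal p).subtypeL
  adjCLM := (orthogonal p).projectionOntoL p h.symm
  inner_adj x y := by
    rw [← sub_eq_zero]
    change inner A (x : E) y - inner A (x : E) ((orthogonal p).projection p h.isCompl.symm y) = 0
    rw [← CStarModule.inner_sub_right]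
    exact inner_eq_zero_of_mem_orthogonal x.2 (Submodule.sub_projection_mem h.isCompl.symm y)

theorem ker_orthogonalSubtype_adjCLM {p : Submodule A E} (h : p.IsTopCompl (orthogonal p)) :
    (orthogonalSubtype h).adjCLM.ker = p :=
  Submodule.ker_projectionOntoL h.symm

theorem orthogonalSubtype_adjCLM_eq {p : Submodule A E} (h : p.IsTopCompl (orthogonal p))
    {x : E} {z : orthogonal p} (hxz : x - z ∈ p) : (orthogonalSubtype h).adjCLM x = z := by
  have hz : (orthogonalSubtype h).adjCLM z = z := Submodule.projectionOntoL_apply_left h.symm z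
  rw [← hz, ← sub_eq_zero, ← map_sub]
  exact (SetLike.ext_iff.1 (ker_orthogonalSubtype_adjCLM h) _).2 hxz

theorem ker_adjCLM (T : AdjointableMap A E F) :
    T.adjCLM.ker = orthogonal T.toCLM.range := by
  ext y
  refine ⟨?_, fun hy => ext_inner A fun x => ?_⟩
  · rintro hy _ ⟨x, rfl⟩
    have hy' : T.adjCLM y = 0 := hy
    exact (T.inner_adj x y).trans (hy' ▸ inner_zero_right)
  · exact (T.inner_adj x y).symm.trans ((hy _ ⟨x, rfl⟩).trans inner_zero_right.symm)

omit [StarOrderedRing A] in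
theorem ker_comp_adjCLM (T : AdjointableMap A E F) :
    (T.toCLM ∘L T.adjCLM).ker = T.adjCLM.ker := by
  refine le_antisymm (fun y hy => ?_) (LinearMap.ker_le_ker_comp _ _)
  have hTy : T.toCLM (T.adjCLM y) = 0 := hy
  refine inner_self.1 (?_ : inner A (T.adjCLM y) (T.adjCLM y) = 0)
  rw [← T.inner_adj, hTy, CStarModule.inner_zero_left]

theorem exists_equiv_adjCLM_toCLM [CompleteSpace E] (T : AdjointableMap A E F) {C : ℝ}
    (hC : 0 < C) (hT : ∀ x, ‖x‖ ≤ C * ‖T.toCLM x‖) :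
    ∃ S : E ≃L[A] E, ∀ x, S x = T.adjCLM (T.toCLM x) := by
  let S := T.adjCLM ∘L T.toCLM
  have hbelow (t : ℝ) (ht : 0 ≤ t) (y : E) : (C ^ 2)⁻¹ * ‖y‖ ≤ ‖S y + t • y‖ := by
    rw [inv_mul_le_iff₀ (by positivity)]
    rcases eq_or_ne y 0 with rfl | hy
    · simp
    refine le_of_mul_le_mul_left ?_ (norm_pos_iff.2 hy)
    calc ‖y‖ * ‖y‖ ≤ (C * ‖T.toCLM y‖) * (C * ‖T.toCLM y‖) := by gcongr <;> exact hT y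
      _ = C ^ 2 * ‖inner A (T.toCLM y) (T.toCLM y)‖ := by rw [← norm_sq_eq A]; ring
      _ ≤ C ^ 2 * ‖inner A y (S y + t • y)‖ := by
        refine mul_le_mul_of_nonneg_left ?_ (by positivity)
        refine CStarAlgebra.norm_le_norm_of_nonneg_of_le inner_self_nonneg ?_
        rw [CStarModule.inner_add_right, T.inner_adj, inner_smul_right_real]
        exact le_add_of_nonneg_right (smul_nonneg ht inner_self_nonneg)
      _ ≤ C ^ 2 * (‖y‖ * ‖S y + t • y‖) := by gcongr; exact norm_inner_le E
      _ = ‖y‖ * (C ^ 2 * ‖S y + t • y‖) := by ring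
  have hbij : Bijective S := ContinuousLinearMap.isUnit_iff_bijective.1
    (isUnit_of_bddBelow (S.restrictScalars ℂ) (by positivity) hbelow)
  have hopen : IsOpenMap S := (S.restrictScalars ℂ).isOpenMap hbij.2
  exact ⟨.ofIsHomeomorph (.ofBijective S.toLinearMap hbij) ⟨S.continuous, hopen, hbij⟩,
    fun _ => rfl⟩

theorem exists_equiv_toCLM_adjCLM [CompleteSpace E] [CompleteSpace F]
    (T : AdjointableMap A E F) (hT : Surjective T.toCLM) :
    ∃ S : F ≃L[A] F, ∀ y, S y = T.toCLM (T.adjCLM y) := by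
  obtain ⟨C, hC, hpre⟩ := (T.toCLM.restrictScalars ℂ).exists_preimage_norm_le hT
  refine T.adjoint.exists_equiv_adjCLM_toCLM hC fun y => ?_
  obtain ⟨x, hx, hxy⟩ := hpre y
  rcases eq_or_ne y 0 with rfl | hy
  · simp
  refine le_of_mul_le_mul_left ?_ (norm_pos_iff.2 hy)
  calc ‖y‖ * ‖y‖ = ‖inner A (T.toCLM x) y‖ := by
        rw [← sq, norm_sq_eq A, show T.toCLM x = y from hx]
    _ = ‖inner A x (T.adjCLM y)‖ := by rw [T.inner_adj]
    _ ≤ ‖x‖ * ‖T.adjCLM y‖ := norm_inner_le E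
    _ ≤ C * ‖y‖ * ‖T.adjCLM y‖ := by gcongr
    _ = ‖y‖ * (C * ‖T.adjCLM y‖) := by ring

/-- An adjointable operator as an operator onto its range. -/
noncomputable def rangeRestrict (T : AdjointableMap A E F) :
    AdjointableMap A E T.toCLM.range where
  toCLM := T.toCLM.rangeRestrict
  adjCLM := T.adjCLM ∘L T.toCLM.range.subtypeL
  inner_adj x y := T.inner_adj x y

theorem isTopCompl_range_orthogonal [CompleteSpace E] [CompleteSpace F]
    (T : AdjointableMap A E F) (hT : IsClosed (T.toCLM.range : Set F)) :
    T.toCLM.range.IsTopCompl (orthogonal T.toCLM.range) := by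
  have : CompleteSpace T.toCLM.range := hT.completeSpace_coe
  obtain ⟨S, hS⟩ := T.rangeRestrict.exists_equiv_toCLM_adjCLM (LinearMap.surjective_rangeRestrict _)
  let P : F →L[A] T.toCLM.range := S.symm ∘L T.rangeRestrict.toCLM ∘L T.adjCLM
  have hP (y : T.toCLM.range) : P y = y := S.symm_apply_eq.2 (hS y).symm
  have hker : P.ker = orthogonal T.toCLM.range := by
    rw [← T.ker_adjCLM, ← T.ker_comp_adjCLM]
    ext y
    exact S.symm.map_eq_zero_iff.trans (Subtype.ext_iff)
  exact hker ▸ ContinuousLinearMap.isTopCompl_of_proj hP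

end AdjointableMap

variable (A) in
/-- The synthesis operator `a ↦ ∑ i, a i • x i` of a finite family; its adjoint is the analysis
operator `y ↦ (⟪x i, y⟫)ᵢ`. -/
noncomputable def synthesis {ι : Type*} [Fintype ι] (x : ι → E) :
    AdjointableMap A C⋆ᵐᵒᵈ(A, ι → A) E where
  toCLM :=
    have : IsBoundedSMul A E := .of_norm_smul_le norm_smul_le'
    let L : (ι → A) →L[A] E := ⟨Fintype.linearCombination A x, by
      change Continuous fun a : ι → A => ∑ i, a i • x i
      fun_prop⟩
    L ∘L (WithCStarModule.equivL A : C⋆ᵐᵒᵈ(A, ι → A) ≃L[A] (ι → A))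
  adjCLM := (WithCStarModule.equivL A : C⋆ᵐᵒᵈ(A, ι → A) ≃L[A] (ι → A)).symm ∘L
    { toFun y i := inner A (x i) y
      map_add' _ _ := funext fun _ => CStarModule.inner_add_right
      map_smul' _ _ := funext fun _ => CStarModule.inner_op_smul_right
      cont := continuous_pi fun i => continuous_inner.comp (.prodMk_right (x i)) }
  inner_adj a y := by
    change inner A (∑ i, a i • x i) y = ∑ i, inner A (x i) y * star (a i)
    simp

theorem isTopCompl_orthogonal_of_fg [CompleteSpace E] {p : Submodule A E}
    (hcl : IsClosed (p : Set E)) (hfg : p.FG) : p.IsTopCompl (orthogonal p) := by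
  obtain ⟨n, x, rfl⟩ := Submodule.fg_iff_exists_fin_generating_family.1 hfg
  have hrange : (synthesis A x).toCLM.range = Submodule.span A (Set.range x) :=
    (LinearEquiv.range_comp (WithCStarModule.linearEquiv A A (Fin n → A))
      (Fintype.linearCombination A x)).trans (Fintype.range_linearCombination A x)
  rw [← hrange] at hcl ⊢
  exact (synthesis A x).isTopCompl_range_orthogonal hcl

end OrthogonalComplement

section Decompositions

attribute [local instance] isScalarTower

variable {A : Type u} [CStarAlgebra A] [PartialOrder A] [StarOrderedRing A]
  {M : Type v} [NormedAddCommGroup M] [NormedSpace ℂ M] [Module A M] [CStarModule A M]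
  {N : Type w} [NormedAddCommGroup N] [NormedSpace ℂ N] [Module A N] [CStarModule A N]
  {F : AdjointableMap A M N}

namespace IsOuterInverse

variable {G : N →L[A] M}

theorem exists_adjoint_of_isTopCompl_ker_comp [CompleteSpace M] (h : IsOuterInverse F.toCLM G)
    (hc : (G ∘L F.toCLM).ker.IsTopCompl (orthogonal (G ∘L F.toCLM).ker)) :
    ∃ H : M →L[A] N, IsOuterInverse F.adjCLM H ∧ H.ker = (G ∘L F.toCLM).ker ∧
      IsCompl H.range G.ker := by
  have : CompleteSpace (orthogonal (G ∘L F.toCLM).ker) := hc.symm.isClosed.completeSpace_coe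
  let ι := AdjointableMap.orthogonalSubtype hc
  have hι (x : M) : ι.adjCLM x = 0 ↔ G (F.toCLM x) = 0 :=
    SetLike.ext_iff.1 (AdjointableMap.ker_orthogonalSubtype_adjCLM hc) x
  let T := F.comp ι
  let L : N →L[A] orthogonal (G ∘L F.toCLM).ker := ι.adjCLM ∘L G
  have hLT : LeftInverse L T.toCLM := fun x =>
    AdjointableMap.orthogonalSubtype_adjCLM_eq hc <| by
      change G (F.toCLM (G (F.toCLM x) - x)) = 0
      rw [map_sub, map_sub, h, sub_self]
  have hkerL : L.ker = G.ker := by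
    ext y
    exact (hι (G y)).trans (by rw [h y]; rfl)
  obtain ⟨C, hC, hL⟩ := exists_norm_apply_le L
  obtain ⟨S, hS⟩ := T.exists_equiv_adjCLM_toCLM hC fun x =>
    (congrArg norm (hLT x)).symm.le.trans (hL (T.toCLM x))
  let R : M →L[A] orthogonal (G ∘L F.toCLM).ker := S.symm ∘L ι.adjCLM
  have hR : Surjective R := S.symm.surjective.comp fun x =>
    ⟨x, AdjointableMap.orthogonalSubtype_adjCLM_eq hc (by simp)⟩
  refine ⟨T.toCLM ∘L R, fun x => ?_, ?_, ?_⟩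
  · exact congrArg T.toCLM (S.symm_apply_eq.2 (hS _).symm)
  · ext x
    exact (map_eq_zero_iff T.toCLM hLT.injective).trans
      ((map_eq_zero_iff _ S.symm.injective).trans (hι x))
  · have hrange : (T.toCLM ∘L R).range = T.toCLM.range :=
      LinearMap.range_comp_of_range_eq_top _ (LinearMap.range_eq_top.2 hR)
    rw [hrange, ← hkerL]
    exact (ContinuousLinearMap.isTopCompl_range_ker_of_leftInverse _ _ hLT).isCompl

theorem exists_adjoint_of_isTopCompl_ker [CompleteSpace M] [CompleteSpace N]
    (h : IsOuterInverse F.toCLM G) (hc : G.ker.IsTopCompl (orthogonal G.ker)) :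
    ∃ H : M →L[A] N, IsOuterInverse F.adjCLM H ∧ H.ker = (G ∘L F.toCLM).ker ∧
      IsCompl H.range G.ker := by
  have : CompleteSpace (orthogonal G.ker) := hc.symm.isClosed.completeSpace_coe
  let ι := AdjointableMap.orthogonalSubtype hc
  have hι (y : N) : ι.adjCLM y = 0 ↔ G y = 0 :=
    SetLike.ext_iff.1 (AdjointableMap.ker_orthogonalSubtype_adjCLM hc) y
  let T := ι.adjoint.comp F
  have hT : Surjective T.toCLM := fun y =>
    ⟨G y, AdjointableMap.orthogonalSubtype_adjCLM_eq hc (by simp [h (y : N)])⟩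
  obtain ⟨S, hS⟩ := T.exists_equiv_toCLM_adjCLM hT
  let R : M →L[A] orthogonal G.ker := S.symm ∘L T.toCLM
  have hR : Surjective R := S.symm.surjective.comp hT
  refine ⟨ι.toCLM ∘L R, fun x => ?_, ?_, ?_⟩
  · exact congrArg ι.toCLM (S.symm_apply_eq.2 (hS _).symm)
  · ext x
    exact (map_eq_zero_iff ι.toCLM Subtype.val_injective).trans
      ((map_eq_zero_iff _ S.symm.injective).trans (hι (F.toCLM x)))
  · have hrange : (ι.toCLM ∘L R).range = orthogonal G.ker :=
      (LinearMap.range_comp_of_range_eq_top _ (LinearMap.range_eq_top.2 hR)).trans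
        (Submodule.range_subtype _)
    rw [hrange]
    exact hc.isCompl.symm

end IsOuterInverse

namespace Decomposition

/-- An outer inverse of `F` as a decomposition of `F`; `Decomposition.outerInverse` goes back. -/
noncomputable def ofOuterInverse {G : N →L[A] M} (h : IsOuterInverse F.toCLM G) :
    Decomposition F where
  M₁ := G.range
  N₁ := (G ∘L F.toCLM).ker
  M₂ := (F.toCLM ∘L G).range
  N₂ := G.ker
  isClosed_M₁ := h.isTopCompl_range_ker_comp.isClosed
  isClosed_N₁ := h.isTopCompl_range_ker_comp.isClosed'
  isClosed_M₂ := h.isTopCompl_range_comp_ker.isClosed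
  isClosed_N₂ := h.isTopCompl_range_comp_ker.isClosed'
  isCompl_dom := h.isTopCompl_range_ker_comp.isCompl
  isCompl_cod := h.isTopCompl_range_comp_ker.isCompl
  F₁ := h.rangeEquiv
  apply_M₁ _ := rfl
  apply_N₁ _ hx := hx

theorem isTopCompl_cod [CompleteSpace N] (D : Decomposition F) : D.M₂.IsTopCompl D.N₂ :=
  isTopCompl_of_isClosed ℂ D.isCompl_cod D.isClosed_M₂ D.isClosed_N₂

variable [CompleteSpace N]

/-- The outer inverse `diag(F₁⁻¹, 0)` of an operator decomposed as `diag(F₁, F₄)`. -/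
noncomputable def outerInverse (D : Decomposition F) : N →L[A] M :=
  D.M₁.subtypeL ∘L D.F₁.symm ∘L D.M₂.projectionOntoL D.N₂ D.isTopCompl_cod

theorem outerInverse_apply_F₁ (D : Decomposition F) (x : D.M₁) :
    D.outerInverse (D.F₁ x) = x := by
  simp [outerInverse]

theorem isOuterInverse_outerInverse (D : Decomposition F) :
    IsOuterInverse F.toCLM D.outerInverse := fun _ =>
  (congrArg D.outerInverse (D.apply_M₁ _)).trans (D.outerInverse_apply_F₁ _)

theorem ker_outerInverse (D : Decomposition F) : D.outerInverse.ker = D.N₂ := by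
  ext y
  simp [outerInverse]

theorem ker_outerInverse_comp (D : Decomposition F) :
    (D.outerInverse ∘L F.toCLM).ker = D.N₁ := by
  have hN₁ : ∀ x ∈ D.N₁, D.outerInverse (F.toCLM x) = 0 := fun x hx =>
    (SetLike.ext_iff.1 D.ker_outerInverse _).2 (D.apply_N₁ x hx)
  refine le_antisymm (fun x hx => ?_) hN₁
  obtain ⟨y, z, hy, hz, rfl⟩ :=
    Submodule.codisjoint_iff_exists_add_eq.1 D.isCompl_dom.codisjoint x
  have hy' : D.outerInverse (F.toCLM y) = y :=
    (congrArg D.outerInverse (D.apply_M₁ ⟨y, hy⟩)).trans (D.outerInverse_apply_F₁ ⟨y, hy⟩)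
  have hyz : D.outerInverse (F.toCLM (y + z)) = 0 := hx
  rw [map_add, map_add, hy', hN₁ z hz, add_zero] at hyz
  rwa [hyz, zero_add]

theorem nonempty_prod_equiv_prod (D D' : Decomposition F) :
    Nonempty ((D.N₁ × D'.N₂) ≃ₗ[A] D.N₂ × D'.N₁) := by
  rw [← D.ker_outerInverse_comp, ← D'.ker_outerInverse_comp, ← D.ker_outerInverse,
    ← D'.ker_outerInverse]
  exact ⟨D.isOuterInverse_outerInverse.kerCompProdKerEquiv D'.isOuterInverse_outerInverse⟩

variable [CompleteSpace M]

theorem exists_adjoint_of_fg_N₁ (D : Decomposition F) (h₁ : D.N₁.FG) :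
    ∃ D' : Decomposition F.adjoint, D'.N₂ = D.N₁ ∧ Nonempty (D'.N₁ ≃ₗ[A] D.N₂) := by
  have hc := isTopCompl_orthogonal_of_fg D.isClosed_N₁ h₁
  rw [← D.ker_outerInverse_comp] at hc
  obtain ⟨H, hH, hker, hrange⟩ :=
    D.isOuterInverse_outerInverse.exists_adjoint_of_isTopCompl_ker_comp hc
  rw [D.ker_outerInverse_comp] at hker
  rw [D.ker_outerInverse] at hrange
  exact ⟨.ofOuterInverse hH, hker, ⟨hH.kerCompEquivOfIsCompl hrange⟩⟩

theorem exists_adjoint_of_fg_N₂ (D : Decomposition F) (h₂ : D.N₂.FG) :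
    ∃ D' : Decomposition F.adjoint, D'.N₂ = D.N₁ ∧ Nonempty (D'.N₁ ≃ₗ[A] D.N₂) := by
  have hc := isTopCompl_orthogonal_of_fg D.isClosed_N₂ h₂
  rw [← D.ker_outerInverse] at hc
  obtain ⟨H, hH, hker, hrange⟩ :=
    D.isOuterInverse_outerInverse.exists_adjoint_of_isTopCompl_ker hc
  rw [D.ker_outerInverse_comp] at hker
  rw [D.ker_outerInverse] at hrange
  exact ⟨.ofOuterInverse hH, hker, ⟨hH.kerCompEquivOfIsCompl hrange⟩⟩

end Decomposition

theorem fg_of_linearEquiv {R : Type*} [Ring R] {V W : Type*} [AddCommGroup V] [Module R V]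
    [AddCommGroup W] [Module R W] {p : Submodule R V} {q : Submodule R W} (e : p ≃ₗ[R] q)
    (hp : p.FG) : q.FG := by
  rw [← Module.Finite.iff_fg] at hp ⊢
  exact Module.Finite.equiv e

theorem mem_mPhiPlus_iff_adjoint_mem_mPhiMinus [CompleteSpace M] [CompleteSpace N] :
    F ∈ MPhiPlus A M N ↔ F.adjoint ∈ MPhiMinus A N M := by
  constructor
  · rintro ⟨D, h₁⟩
    obtain ⟨D', hN, -⟩ := D.exists_adjoint_of_fg_N₁ h₁
    exact ⟨D', hN ▸ h₁⟩
  · rintro ⟨D, h₂⟩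
    obtain ⟨D', -, ⟨e⟩⟩ := D.exists_adjoint_of_fg_N₂ h₂
    exact ⟨D', fg_of_linearEquiv e.symm h₂⟩

end Decompositions

section Index

theorem KGroup.cls_eq_of_equiv {R : Type u} [Ring R] {P Q : FGProjective R}
    (e : P.carrier ≃ₗ[R] Q.carrier) : KGroup.cls P = KGroup.cls Q :=
  congrArg Algebra.GrothendieckAddGroup.of (Quotient.sound ⟨e⟩)

theorem KGroup.cls_add_cls {R : Type u} [Ring R] (P Q : FGProjective R) :
    KGroup.cls P + KGroup.cls Q = KGroup.cls ⟨P.carrier × Q.carrier⟩ :=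
  (map_add Algebra.GrothendieckAddGroup.of _ _).symm

variable {A : Type u} [CStarAlgebra A] [PartialOrder A] [StarOrderedRing A]
  {M : Type u} [NormedAddCommGroup M] [NormedSpace ℂ M] [Module A M] [CStarModule A M]
  [CompleteSpace M]
  {N : Type u} [NormedAddCommGroup N] [NormedSpace ℂ N] [Module A N] [CStarModule A N]
  [CompleteSpace N]
  {F : AdjointableMap A M N}

theorem submoduleClass_eq_of_equiv {P : Submodule A M} {Q : Submodule A N}
    (hP : IsClosed (P : Set M)) (hPfg : P.FG) (hQ : IsClosed (Q : Set N)) (hQfg : Q.FG)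
    (e : P ≃ₗ[A] Q) : submoduleClass P hP hPfg = submoduleClass Q hQ hQfg :=
  KGroup.cls_eq_of_equiv e

theorem Decomposition.index_eq_index (D D' : Decomposition F) (h₁ : D.N₁.FG) (h₂ : D.N₂.FG)
    (h₁' : D'.N₁.FG) (h₂' : D'.N₂.FG) : D.index h₁ h₂ = D'.index h₁' h₂' := by
  obtain ⟨e⟩ := D.nonempty_prod_equiv_prod D'
  rw [Decomposition.index, Decomposition.index, sub_eq_sub_iff_add_eq_add,
    add_comm (submoduleClass D'.N₁ _ _)]
  simp only [submoduleClass, KGroup.cls_add_cls]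
  exact KGroup.cls_eq_of_equiv e

theorem Decomposition.index_eq (D : Decomposition F) (h₁ : D.N₁.FG) (h₂ : D.N₂.FG)
    (hF : F ∈ MPhi A M N) : D.index h₁ h₂ = HilbertMod.index F hF :=
  D.index_eq_index _ h₁ h₂ _ _

theorem exists_adjoint_mem_mPhi (hF : F ∈ MPhi A M N) :
    ∃ hF' : F.adjoint ∈ MPhi A N M, index F hF = -index F.adjoint hF' := by
  obtain ⟨D, h₁, h₂⟩ := id hF
  obtain ⟨D', hN, ⟨e⟩⟩ := D.exists_adjoint_of_fg_N₁ h₁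
  have h₁' : D'.N₁.FG := fg_of_linearEquiv e.symm h₂
  have h₂' : D'.N₂.FG := hN ▸ h₁
  have hF' : F.adjoint ∈ MPhi A N M := ⟨D', h₁', h₂'⟩
  refine ⟨hF', ?_⟩
  calc index F hF = D.index h₁ h₂ := (D.index_eq h₁ h₂ hF).symm
    _ = submoduleClass D'.N₂ D'.isClosed_N₂ h₂' - submoduleClass D'.N₁ D'.isClosed_N₁ h₁' :=
      congrArg₂ _ (submoduleClass_eq_of_equiv _ _ _ _ (.ofEq _ _ hN.symm))
        (submoduleClass_eq_of_equiv _ _ _ _ e.symm)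
    _ = -D'.index h₁' h₂' := (neg_sub _ _).symm
    _ = -index F.adjoint hF' := congrArg Neg.neg (D'.index_eq h₁' h₂' hF')

end Index

end HilbertMod

theorem corollary2p11_general {A : Type u} [CStarAlgebra A] [PartialOrder A] [StarOrderedRing A] :
    (∀ (M : Type v) [NormedAddCommGroup M] [NormedSpace ℂ M] [Module A M] [CStarModule A M]
        [CompleteSpace M]
        (N : Type w) [NormedAddCommGroup N] [NormedSpace ℂ N] [Module A N] [CStarModule A N]
        [CompleteSpace N] (F : AdjointableMap A M N),
        F ∈ MPhiPlus A M N ↔ F.adjoint ∈ MPhiMinus A N M) ∧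
    (∀ (M : Type u) [NormedAddCommGroup M] [NormedSpace ℂ M] [Module A M] [CStarModule A M]
        [CompleteSpace M]
        (N : Type u) [NormedAddCommGroup N] [NormedSpace ℂ N] [Module A N] [CStarModule A N]
        [CompleteSpace N] (F : AdjointableMap A M N) (hF : F ∈ MPhi A M N),
        (∀ (D : Decomposition F) (h₁ : D.N₁.FG) (h₂ : D.N₂.FG), D.index h₁ h₂ = index F hF) ∧
        ∃ hF' : F.adjoint ∈ MPhi A N M,
          (∀ (D : Decomposition F.adjoint) (h₁ : D.N₁.FG) (h₂ : D.N₂.FG),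
            D.index h₁ h₂ = index F.adjoint hF') ∧
          index F hF = -index F.adjoint hF') := by
  refine ⟨fun _ _ _ _ _ _ _ _ _ _ _ _ _ => mem_mPhiPlus_iff_adjoint_mem_mPhiMinus,
    fun _ _ _ _ _ _ _ _ _ _ _ _ _ hF => ⟨fun D h₁ h₂ => D.index_eq h₁ h₂ hF, ?_⟩⟩
  obtain ⟨hF', hindex⟩ := exists_adjoint_mem_mPhi hF
  exact ⟨hF', fun D h₁ h₂ => D.index_eq h₁ h₂ hF', hindex⟩

theorem corollary2p11 {A : Type u} [CStarAlgebra A] [PartialOrder A] [StarOrderedRing A] :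
    (∀ (M : Type v) [NormedAddCommGroup M] [NormedSpace ℂ M] [Module A M] [CStarModule A M]
        [CompleteSpace M]
        (N : Type w) [NormedAddCommGroup N] [NormedSpace ℂ N] [Module A N] [CStarModule A N]
        [CompleteSpace N] (F : AdjointableMap A M N),
        F ∈ MPhiPlus A M N ↔ F.adjoint ∈ MPhiMinus A N M) ∧
    (∀ (F : AdjointableMap A (StandardModule A) (StandardModule A))
        (hF : F ∈ MPhi A (StandardModule A) (StandardModule A)),
        (∀ (D : Decomposition F) (h₁ : D.N₁.FG) (h₂ : D.N₂.FG), D.index h₁ h₂ = index F hF) ∧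
        ∃ hF' : F.adjoint ∈ MPhi A (StandardModule A) (StandardModule A),
          (∀ (D : Decomposition F.adjoint) (h₁ : D.N₁.FG) (h₂ : D.N₂.FG),
            D.index h₁ h₂ = index F.adjoint hF') ∧
          index F hF = -index F.adjoint hF') :=
  ⟨corollary2p11_general.1, fun F hF => corollary2p11_general.{u, v, w}.2 _ _ F hF⟩
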